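/- **Setting.** Let $\mathscr L$ be a many-sorted first-order language, $\kappa>|\mathscr L|$ a strong limit cardinal (where $|\mathscr L|$ is the number of $\mathscr L$-formulas), and $\mathfrak M$ an infinite $\kappa$-saturated $\mathscr L$-structure. "Small" means of cardinality $<\kappa$. For a small set $A$ of elements of $\mathfrak M$, a set of finite tuples is $\bigwedge_A$-definable if it is the set of realisations of a set of formulas with parameters in $A$. An $A$-hyperdefinable set is a quotient $X/E$ of a non-empty $\bigwedge_A$-definable set $X$ by an $\bigwedge_A$-definable equivalence relation $E$; subsets of it, and relations between such quotients, are $\bigwedge_A$-definable if their preimages in $X$, respectively in the products of the $X$'s, are. A piecewise $A$-hyperdefinable set is a direct limit $P=\varinjlim_{i\in I}P_i$, over a directed ordered set $I$ of cofinality $<\kappa$, of $A$-hyperdefinable sets with injective $\bigwedge_A$-definable transition maps; the images of the $P_i$ in $P$ are its pieces. A subset of $P$ is piecewise $\bigwedge_A$-definable if its preimage in every $P_i$ is $\bigwedge_A$-definable, it is $\bigwedge_A$-definable if moreover it is contained in a piece, and it is $\bigwedge$-definable if it is $\bigwedge_A$-definable for some small $A$. For every small $A$ over which $P$ is piecewise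 hyperdefinable, the $A$-logic topology on $P$ is the one whose closed sets are the piecewise $\bigwedge_A$-definable sets; $P$ is locally hyperdefinable if for some such $A$ every point has an $\bigwedge_A$-definable neighbourhood in the $A$-logic topology. A piecewise hyperdefinable group is a group $G$ whose universe is, for some small $A$, a piecewise $A$-hyperdefinable set such that multiplication and inversion are piecewise $\bigwedge_A$-definable (the restriction of the graph to any pieces is $\bigwedge_A$-definable) and piecewise bounded (the product of two pieces is contained in a piece, and so is the inverse of a piece). A subset $V\subseteq G$ is symmetric if $1\in V=V^{-1}$, and $V^0=\{1\}$, $V^{n+1}=VV^n$. A generic set is an $\bigwedge$-definable $V\subseteq G$ such that for every $\bigwedge$-definable $W\subseteq G$ there is a finite $\Delta\subseteq G$ with $W\subseteq\Delta V$. **Theorem (Generic Set Lemma).** Let $G$ be a piecewise hyperdefinable group. 1. If $V\subseteq G$ is a symmetric generic set, then there is a small set $A$ of parameters over which $G$ is piecewise hyperdefinable and such that, for every $n\in\mathbb N$, $V^{n+2}$ is a neighbourhood of $V^n$ in the $A$-logic topology. 2. If some piece of $G$ is generic, then $G$ is locally hyperdefinable. 3. If $|G|<\kappa$, then $G$ is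 locally hyperdefinable if and only if some piece of $G$ is generic. -/

import Mathlib

open Set Topology Cardinal
open scoped Pointwise

universe u

/-! ## Many-sorted first-order logic -/

/-- A many-sorted first-order language: a set of sorts, and sets of function and relation symbols.
The arity of a symbol is a finite list of sorts. -/
structure ManySortedLanguage where
  Srt : Type u
  Fn : List Srt → Srt → Type u
  Rel : List Srt → Type u

namespace ManySortedLanguage

/-- `Var Γ s` is the set of positions of the list `Γ` at which the sort is `s`: if `Γ` is the list
of sorts of a finite tuple of variables, these are the variables of sort `s` in the tuple. -/
inductive Var {S : Type u} : List S → S → Type u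
  | head {Γ : List S} {s : S} : Var (s :: Γ) s
  | tail {Γ : List S} {s t : S} (x : Var Γ s) : Var (t :: Γ) s

/-- `Tuple M Γ` is the product `M s₁ × ⋯ × M sₙ` for `Γ = [s₁, …, sₙ]`. -/
def Tuple {S : Type u} (M : S → Type u) (Γ : List S) : Type u :=
  ∀ ⦃s : S⦄, Var Γ s → M s

/-- Adding one element in front of a tuple. -/
def Tuple.cons {S : Type u} {M : S → Type u} {Γ : List S} {s : S} (a : M s) (v : Tuple M Γ) :
    Tuple M (s :: Γ) := fun _ x =>
  match x with
  | .head => a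
  | .tail y => v y

/-- Removing the first element of a tuple. -/
def Tuple.rest {S : Type u} {M : S → Type u} {Γ : List S} {s : S} (v : Tuple M (s :: Γ)) :
    Tuple M Γ := fun _ x => v x.tail

/-- Concatenation of tuples. -/
def Tuple.append {S : Type u} {M : S → Type u} {Δ : List S} :
    {Γ : List S} → Tuple M Γ → Tuple M Δ → Tuple M (Γ ++ Δ)
  | [], _, w => w
  | _ :: _, v, w => Tuple.cons (v .head) (Tuple.append v.rest w)

/-- A structure for a many-sorted language. -/
structure Struct (L : ManySortedLanguage.{u}) where
  carrier : L.Srt → Type u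
  fn : ∀ {Γ : List L.Srt} {s : L.Srt}, L.Fn Γ s → Tuple carrier Γ → carrier s
  rel : ∀ {Γ : List L.Srt}, L.Rel Γ → Tuple carrier Γ → Prop

/-- Terms of sort `s`, with variables in the context `Γ`, and with additional constant symbols
`C t` of each sort `t`. -/
inductive Term (L : ManySortedLanguage.{u}) (C : L.Srt → Type u) (Γ : List L.Srt) :
    L.Srt → Type u
  | var {s : L.Srt} (x : Var Γ s) : Term L C Γ s
  | const {s : L.Srt} (c : C s) : Term L C Γ s
  | app {Δ : List L.Srt} {s : L.Srt} (f : L.Fn Δ s) (ts : ∀ ⦃t : L.Srt⦄, Var Δ t → Term L C Γ t) :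
      Term L C Γ s

/-- First-order formulas with free variables in the context `Γ`, and with additional constant
symbols `C t` of each sort `t`. The quantifier binds the first variable of the context. -/
inductive Formula (L : ManySortedLanguage.{u}) (C : L.Srt → Type u) : List L.Srt → Type u
  | falsum {Γ : List L.Srt} : Formula L C Γ
  | equal {Γ : List L.Srt} {s : L.Srt} (t₁ t₂ : Term L C Γ s) : Formula L C Γ
  | rel {Γ Δ : List L.Srt} (R : L.Rel Δ) (ts : ∀ ⦃t : L.Srt⦄, Var Δ t → Term L C Γ t) :
      Formula L C Γ
  | imp {Γ : List L.Srt} (φ ψ : Formula L C Γ) : Formula L C Γ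
  | all {Γ : List L.Srt} (s : L.Srt) (φ : Formula L C (s :: Γ)) : Formula L C Γ

variable {L : ManySortedLanguage.{u}}

/-- The value of a term in `M`, given an interpretation `c` of the additional constants and
values `v` of the variables. -/
def Term.eval (M : L.Struct) {C : L.Srt → Type u} (c : ∀ ⦃s : L.Srt⦄, C s → M.carrier s)
    {Γ : List L.Srt} (v : Tuple M.carrier Γ) : {s : L.Srt} → Term L C Γ s → M.carrier s
  | _, .var x => v x
  | _, .const a => c a
  | _, .app f ts => M.fn f fun _ x => (ts x).eval M c v

/-- Satisfaction of a formula in `M`. -/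
def Formula.Realize (M : L.Struct) {C : L.Srt → Type u}
    (c : ∀ ⦃s : L.Srt⦄, C s → M.carrier s) :
    {Γ : List L.Srt} → Formula L C Γ → Tuple M.carrier Γ → Prop
  | _, .falsum, _ => False
  | _, .equal t₁ t₂, v => t₁.eval M c v = t₂.eval M c v
  | _, .rel R ts, v => M.rel R fun _ x => (ts x).eval M c v
  | _, .imp φ ψ, v => φ.Realize M c v → ψ.Realize M c v
  | _, .all s φ, v => ∀ a : M.carrier s, φ.Realize M c (Tuple.cons a v)

/-- The cardinality of a language is the number of its formulas (without parameters). -/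
noncomputable def card (L : ManySortedLanguage.{u}) : Cardinal.{u} :=
  #(Σ Γ : List L.Srt, Formula L (fun _ => PEmpty) Γ)

namespace Struct

variable (M : L.Struct)

/-- A set of parameters (real elements) of `M`: a subset of each sort. -/
abbrev Params : Type u := ∀ s : L.Srt, Set (M.carrier s)

/-- A set of parameters is `κ`-small if it has fewer than `κ` elements. -/
def Params.Small {M : L.Struct} (A : M.Params) (κ : Cardinal.{u}) : Prop :=
  #(Σ s : L.Srt, A s) < κ

/-- Formulas with parameters from `A`, in the context `Γ`. -/
abbrev FormulaOver (A : M.Params) (Γ : List L.Srt) : Type u := Formula L (fun s => A s) Γ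

variable {M}

/-- `φ.Holds v` means that the tuple `v` of `M` satisfies the formula `φ` with parameters. -/
def FormulaOver.Holds {A : M.Params} {Γ : List L.Srt} (φ : M.FormulaOver A Γ)
    (v : Tuple M.carrier Γ) : Prop :=
  Formula.Realize M (fun _ a => a.1) φ v

variable (M)

/-- `M` is `κ`-saturated: every finitely satisfiable set of formulas in a finite tuple of variables,
with parameters from a fixed set of fewer than `κ` elements, is satisfied in `M`. -/
def Saturated (κ : Cardinal.{u}) : Prop :=
  ∀ A : M.Params, A.Small κ → ∀ (Γ : List L.Srt) (p : Set (M.FormulaOver A Γ)),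
    (∀ q ⊆ p, q.Finite → ∃ v, ∀ φ ∈ q, FormulaOver.Holds φ v) →
      ∃ v, ∀ φ ∈ p, FormulaOver.Holds φ v

/-- The standing assumptions on the ambient structure: it is infinite and `κ`-saturated for a
strong limit cardinal `κ` greater than the cardinality of the language. -/
structure IsAmbient (κ : Cardinal.{u}) : Prop where
  infinite : Infinite (Σ s : L.Srt, M.carrier s)
  strongLimit : κ.IsStrongLimit
  card_lt : L.card < κ
  saturated : M.Saturated κ

variable {M}

/-- `X` is `⋀_A`-definable: it is the set of realisations of a set of formulas with parameters
from `A`. -/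
def InfDef (A : M.Params) {Γ : List L.Srt} (X : Set (Tuple M.carrier Γ)) : Prop :=
  ∃ p : Set (M.FormulaOver A Γ), X = {v | ∀ φ ∈ p, FormulaOver.Holds φ v}

theorem InfDef.empty (A : M.Params) (Γ : List L.Srt) :
    InfDef A (∅ : Set (Tuple M.carrier Γ)) := by
  refine ⟨{.falsum}, ?_⟩
  ext v
  simp [FormulaOver.Holds, Formula.Realize]

theorem InfDef.iInter {A : M.Params} {Γ : List L.Srt} {ι : Type*}
    {X : ι → Set (Tuple M.carrier Γ)} (h : ∀ i, InfDef A (X i)) : InfDef A (⋂ i, X i) := by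
  choose p hp using h
  refine ⟨⋃ i, p i, ?_⟩
  ext v
  simp only [Set.mem_iInter, Set.mem_ofPred_eq, Set.mem_iUnion]
  constructor
  · rintro hv φ ⟨i, hφ⟩
    have := hv i
    rw [hp i] at this
    exact this φ hφ
  · intro hv i
    rw [hp i]
    exact fun φ hφ => hv φ ⟨i, hφ⟩

theorem InfDef.union {A : M.Params} {Γ : List L.Srt} {X Y : Set (Tuple M.carrier Γ)}
    (hX : InfDef A X) (hY : InfDef A Y) : InfDef A (X ∪ Y) := by
  obtain ⟨p, rfl⟩ := hX
  obtain ⟨q, rfl⟩ := hY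
  refine ⟨{θ | ∃ φ ∈ p, ∃ ψ ∈ q, θ = .imp (.imp φ .falsum) ψ}, ?_⟩
  ext v
  simp only [Set.mem_union, Set.mem_ofPred_eq]
  constructor
  · rintro (h | h) _ ⟨φ, hφ, ψ, hψ, rfl⟩
    · exact fun hn => (hn (h φ hφ)).elim
    · exact fun _ => h ψ hψ
  · intro h
    by_contra! hc
    obtain ⟨⟨φ, hφ, hφv⟩, ψ, hψ, hψv⟩ := hc
    exact hψv (h _ ⟨φ, hφ, ψ, hψ, rfl⟩ hφv)

end Struct

end ManySortedLanguage

/-! ## Hyperdefinable sets -/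

open ManySortedLanguage

/-- A quotient `X / E`, where `X` is a non-empty set of `Γ`-tuples of `M` and `E` is an equivalence
relation on `X`. It is a hyperdefinable set over the parameter sets `A` with `IsOver A`. -/
structure HyperSet {L : ManySortedLanguage.{u}} (M : L.Struct) where
  ctx : List L.Srt
  X : Set (Tuple M.carrier ctx)
  nonempty : X.Nonempty
  E : Setoid X

namespace HyperSet

variable {L : ManySortedLanguage.{u}} {M : L.Struct}

/-- The elements of `X / E`. -/
def Elt (P : HyperSet M) : Type u := Quotient P.E

/-- The quotient map `X → X / E`. -/
def proj (P : HyperSet M) (x : P.X) : P.Elt := Quotient.mk P.E x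

/-- The preimage in `X` of a subset of `X / E`, as a set of tuples. -/
def preimage (P : HyperSet M) (V : Set P.Elt) : Set (Tuple M.carrier P.ctx) :=
  {v | ∃ x : P.X, x.1 = v ∧ P.proj x ∈ V}

/-- A subset of `X / E` is `⋀_A`-definable if its preimage in `X` is. -/
def InfDef (A : M.Params) (P : HyperSet M) (V : Set P.Elt) : Prop :=
  Struct.InfDef A (P.preimage V)

/-- A relation between two quotients is `⋀_A`-definable if its preimage in the product `X × Y`
is. -/
def InfDefRel₂ (A : M.Params) (P Q : HyperSet M) (R : P.Elt → Q.Elt → Prop) : Prop :=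
  Struct.InfDef A {v : Tuple M.carrier (P.ctx ++ Q.ctx) |
    ∃ (x : P.X) (y : Q.X), x.1.append y.1 = v ∧ R (P.proj x) (Q.proj y)}

/-- A relation between three quotients is `⋀_A`-definable if its preimage in the product
`X × Y × Z` is. -/
def InfDefRel₃ (A : M.Params) (P Q T : HyperSet M) (R : P.Elt → Q.Elt → T.Elt → Prop) : Prop :=
  Struct.InfDef A {v : Tuple M.carrier (P.ctx ++ (Q.ctx ++ T.ctx)) |
    ∃ (x : P.X) (y : Q.X) (z : T.X), x.1.append (y.1.append z.1) = v ∧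
      R (P.proj x) (Q.proj y) (T.proj z)}

/-- `X / E` is `A`-hyperdefinable: `X` and `E` are `⋀_A`-definable. -/
structure IsOver (A : M.Params) (P : HyperSet M) : Prop where
  carrier : Struct.InfDef A P.X
  equiv : Struct.InfDef A {v : Tuple M.carrier (P.ctx ++ P.ctx) |
    ∃ x y : P.X, x.1.append y.1 = v ∧ P.E.r x y}

end HyperSet

/-! ## Piecewise hyperdefinable sets -/

/-- A direct system, indexed by a directed ordered set `I`, of quotients `X i / E i` with injective
transition maps. Its direct limit is a piecewise hyperdefinable set over the parameter sets `A` with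
`IsOver A`. -/
structure PiecewiseHyperSet {L : ManySortedLanguage.{u}} (M : L.Struct) where
  I : Type u
  [preorder : Preorder I]
  [directed : IsDirectedOrder I]
  [nonempty : Nonempty I]
  part : I → HyperSet M
  map : ∀ i j : I, i ≤ j → ((part i).Elt ↪ (part j).Elt)
  [system : DirectedSystem (fun i => (part i).Elt) (fun i j h => map i j h)]

attribute [instance] PiecewiseHyperSet.preorder PiecewiseHyperSet.directed
  PiecewiseHyperSet.nonempty PiecewiseHyperSet.system

namespace PiecewiseHyperSet

variable {L : ManySortedLanguage.{u}} {M : L.Struct}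

/-- The underlying set: the direct limit of the system. -/
def Elt (P : PiecewiseHyperSet M) : Type u := DirectLimit (fun i => (P.part i).Elt) P.map

/-- The canonical inclusion of a part in the direct limit. -/
def incl (P : PiecewiseHyperSet M) (i : P.I) (x : (P.part i).Elt) : P.Elt :=
  Quotient.mk _ ⟨i, x⟩

/-- The pieces are the images of the canonical inclusions. -/
def piece (P : PiecewiseHyperSet M) (i : P.I) : Set P.Elt := Set.range (P.incl i)

/-- `P` is piecewise `A`-hyperdefinable: all the parts are `A`-hyperdefinable and all the transition
maps are `⋀_A`-definable. -/
structure IsOver (A : M.Params) (P : PiecewiseHyperSet M) : Prop where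
  part : ∀ i, (P.part i).IsOver A
  map : ∀ (i j : P.I) (h : i ≤ j),
    HyperSet.InfDefRel₂ A (P.part i) (P.part j) fun x y => P.map i j h x = y

/-- `V` is piecewise `⋀_A`-definable: its preimage in every part is `⋀_A`-definable. -/
def PiecewiseInfDef (A : M.Params) (P : PiecewiseHyperSet M) (V : Set P.Elt) : Prop :=
  ∀ i, (P.part i).InfDef A (P.incl i ⁻¹' V)

/-- `V` is `⋀_A`-definable: it is piecewise `⋀_A`-definable and contained in some piece. -/
def InfDef (A : M.Params) (P : PiecewiseHyperSet M) (V : Set P.Elt) : Prop :=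
  P.PiecewiseInfDef A V ∧ ∃ i, V ⊆ P.piece i

/-- `V` is `⋀`-definable: it is `⋀_A`-definable for some set `A` of fewer than `κ` parameters. -/
def SmallInfDef (κ : Cardinal.{u}) (P : PiecewiseHyperSet M) (V : Set P.Elt) : Prop :=
  ∃ A : M.Params, A.Small κ ∧ P.InfDef A V

/-- The `A`-logic topology of a piecewise `A`-hyperdefinable set: the closed sets are the
piecewise `⋀_A`-definable subsets. -/
@[reducible]
def logicTopology (A : M.Params) (P : PiecewiseHyperSet M) (hP : P.IsOver A) :
    TopologicalSpace P.Elt :=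
  TopologicalSpace.ofClosed {V | P.PiecewiseInfDef A V}
    (by
      intro i
      have h : (P.part i).preimage (P.incl i ⁻¹' ∅) = ∅ := by
        ext v
        simp [HyperSet.preimage]
      unfold HyperSet.InfDef
      rw [h]
      exact Struct.InfDef.empty A _)
    (by
      intro T hT i
      have h : (P.part i).preimage (P.incl i ⁻¹' ⋂₀ T) =
          ⋂ o : Option T, o.elim (P.part i).X
            fun V => (P.part i).preimage (P.incl i ⁻¹' V.1) := by
        ext v
        simp only [HyperSet.preimage, Set.mem_ofPred_eq, Set.mem_iInter, Set.mem_preimage,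
          Set.mem_sInter]
        constructor
        · rintro ⟨x, rfl, hx⟩ (_ | V)
          · exact x.2
          · exact ⟨x, rfl, hx V.1 V.2⟩
        · intro hv
          refine ⟨⟨v, hv none⟩, rfl, fun V hV => ?_⟩
          obtain ⟨x, rfl, hx⟩ := hv (some ⟨V, hV⟩)
          exact hx
      unfold HyperSet.InfDef
      rw [h]
      refine Struct.InfDef.iInter fun o => ?_
      cases o with
      | none => exact (hP.part i).carrier
      | some V => exact hT V.2 i)
    (by
      intro V hV W hW i
      have h : (P.part i).preimage (P.incl i ⁻¹' (V ∪ W)) =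
          (P.part i).preimage (P.incl i ⁻¹' V) ∪ (P.part i).preimage (P.incl i ⁻¹' W) := by
        ext v
        simp only [HyperSet.preimage, Set.mem_ofPred_eq, Set.mem_preimage, Set.mem_union]
        constructor
        · rintro ⟨x, rfl, hx | hx⟩
          · exact Or.inl ⟨x, rfl, hx⟩
          · exact Or.inr ⟨x, rfl, hx⟩
        · rintro (⟨x, rfl, hx⟩ | ⟨x, rfl, hx⟩)
          · exact ⟨x, rfl, Or.inl hx⟩
          · exact ⟨x, rfl, Or.inr hx⟩
      unfold HyperSet.InfDef
      rw [h]
      exact Struct.InfDef.union (hV i) (hW i))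

/-- `P` is locally hyperdefinable: for some set `A` of fewer than `κ` parameters over which `P` is
piecewise hyperdefinable, every point has an `⋀_A`-definable neighbourhood in the `A`-logic
topology. -/
def IsLocallyHyperdefinable (κ : Cardinal.{u}) (P : PiecewiseHyperSet M) : Prop :=
  ∃ (A : M.Params) (_ : A.Small κ) (hA : P.IsOver A),
    ∀ x : P.Elt, ∃ N : Set P.Elt, P.InfDef A N ∧ N ∈ @nhds _ (P.logicTopology A hA) x

/-! ## Piecewise hyperdefinable groups -/

/-- `G` is a piecewise `A`-hyperdefinable group: it is a piecewise `A`-hyperdefinable set and its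
multiplication and inversion are piecewise bounded and piecewise `⋀_A`-definable. -/
structure IsGroupOver (A : M.Params) (G : PiecewiseHyperSet M) [Group G.Elt] : Prop where
  isOver : G.IsOver A
  mul_bounded : ∀ i j, ∃ k, G.piece i * G.piece j ⊆ G.piece k
  inv_bounded : ∀ i, ∃ j, (G.piece i)⁻¹ ⊆ G.piece j
  mul_infDef : ∀ i j k, HyperSet.InfDefRel₃ A (G.part i) (G.part j) (G.part k)
    fun x y z => G.incl i x * G.incl j y = G.incl k z
  inv_infDef : ∀ i j, HyperSet.InfDefRel₂ A (G.part i) (G.part j)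
    fun x y => (G.incl i x)⁻¹ = G.incl j y

/-- `G` is a piecewise hyperdefinable group (relative to `κ`): it is a piecewise
`A`-hyperdefinable group for some set `A` of fewer than `κ` parameters, and its cofinality is
smaller than `κ`. -/
structure IsPiecewiseHyperdefinableGroup (κ : Cardinal.{u}) (G : PiecewiseHyperSet M)
    [Group G.Elt] : Prop where
  exists_isGroupOver : ∃ A : M.Params, A.Small κ ∧ G.IsGroupOver A
  cof_lt : Order.cof G.I < κ

/-- A generic set: an `⋀`-definable set finitely many left translates of which cover any given
`⋀`-definable set. -/
def IsGeneric (κ : Cardinal.{u}) (G : PiecewiseHyperSet M) [Group G.Elt] (V : Set G.Elt) : Prop :=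
  G.SmallInfDef κ V ∧
    ∀ W : Set G.Elt, G.SmallInfDef κ W → ∃ Δ : Set G.Elt, Δ.Finite ∧ W ⊆ Δ * V

end PiecewiseHyperSet

namespace ManySortedLanguage

/-! ### Variables and tuples -/

section Tuples

variable {S : Type u} {M : S → Type u}

/-! The core is that, for generic `V` and a suitable small `A`, the set `S * (V⁻¹ * V)` is a
neighbourhood of every `S`. If a translate `g • V` meets `T`, it is contained in `T * (V⁻¹ * V)`. So
the part of a piece outside `T * (V⁻¹ * V)` is covered by those of finitely many closed translates
that miss `T`, hence by a closed set disjoint from `T`. Taking `T = S` separates `S` from the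
closures of the sets `P i \ S * (V⁻¹ * V)`. Taking `T` to be a piece shows that these closures
stabilise on each piece, so that their union is closed. This is `mul_inv_mul_mem_nhdsSet`;
continuity of multiplication is not needed.

The translates become closed once `A` contains representatives of the translating elements: `g • V`
is then the projection of an `⋀_A`-definable set, and saturation makes projections `⋀_A`-definable.
Finitely many elements for each index in a cofinal set suffice, so cofinality below `κ` keeps `A`
small (`IsGeneric.exists_params`).

For symmetric `V`, `V ^ n * (V⁻¹ * V) = V ^ (n + 2)`. For `V` a piece, each `S * (V⁻¹ * V)` with `S`
a piece lies in a piece, which gives local hyperdefinability. Conversely, if `#G.Elt < κ`,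
representatives of all elements fit in `A`, and compactness extracts a finite cover from the
translates of an open neighbourhood of `1`. -/

instance Var.finite_sigma : (Γ : List S) → Finite (Σ s, Var Γ s)
  | [] => Finite.of_injective (β := Empty) (fun x => nomatch x.2) fun x => nomatch x.2
  | t :: Γ => by
    have := Var.finite_sigma Γ
    refine Finite.of_surjective
      (fun o : Option (Σ s, Var Γ s) => o.elim (⟨t, .head⟩ : Σ s, Var (t :: Γ) s)
        fun x => ⟨x.1, x.2.tail⟩) ?_
    rintro ⟨s, x⟩
    cases x with
    | head => exact ⟨none, rfl⟩
    | tail y => exact ⟨some ⟨s, y⟩, rfl⟩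

/-- The inclusion of the variables of the first context in those of a concatenation. -/
def Var.inl {Δ : List S} : {Γ : List S} → {s : S} → Var Γ s → Var (Γ ++ Δ) s
  | _, _, .head => .head
  | _, _, .tail x => .tail x.inl

@[simp]
theorem Tuple.append_inl {Δ : List S} : ∀ {Γ : List S} {s : S} (v : Tuple M Γ) (w : Tuple M Δ)
    (x : Var Γ s), v.append w x.inl = v x
  | _, _, _, _, .head => rfl
  | _, _, v, w, .tail x => Tuple.append_inl v.rest w x

theorem Tuple.cons_head_rest {Γ : List S} {s : S} (v : Tuple M (s :: Γ)) :
    Tuple.cons (v .head) v.rest = v := by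
  funext t x
  cases x <;> rfl

end Tuples

variable {L : ManySortedLanguage.{u}} {C D : L.Srt → Type u}

/-! ### Substitution -/

/-- Replacing variables by variables or constants, and constants by constants, in a term. -/
def Term.subst {Γ Δ : List L.Srt} (σ : ∀ ⦃s : L.Srt⦄, Var Γ s → Var Δ s ⊕ D s)
    (c : ∀ ⦃s : L.Srt⦄, C s → D s) : {s : L.Srt} → Term L C Γ s → Term L D Δ s
  | _, .var x => Sum.elim .var .const (σ x)
  | _, .const a => .const (c a)
  | _, .app f ts => .app f fun _ x => (ts x).subst σ c

/-- Extending a substitution to one more variable. -/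
def liftSubst {Γ Δ : List L.Srt} (s : L.Srt)
    (σ : ∀ ⦃t : L.Srt⦄, Var Γ t → Var Δ t ⊕ D t) :
    ∀ ⦃t : L.Srt⦄, Var (s :: Γ) t → Var (s :: Δ) t ⊕ D t
  | _, .head => .inl .head
  | _, .tail x => (σ x).map .tail id

/-- Replacing variables by variables or constants, and constants by constants, in a formula. -/
def Formula.subst (c : ∀ ⦃s : L.Srt⦄, C s → D s) : {Γ Δ : List L.Srt} →
    (∀ ⦃s : L.Srt⦄, Var Γ s → Var Δ s ⊕ D s) → Formula L C Γ → Formula L D Δ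
  | _, _, _, .falsum => .falsum
  | _, _, σ, .equal t₁ t₂ => .equal (t₁.subst σ c) (t₂.subst σ c)
  | _, _, σ, .rel R ts => .rel R fun _ x => (ts x).subst σ c
  | _, _, σ, .imp φ ψ => .imp (φ.subst c σ) (ψ.subst c σ)
  | _, _, σ, .all s φ => .all s (φ.subst c (liftSubst s σ))

/-- The tuple of values of the variables and constants substituted for a tuple of variables. -/
def Tuple.pull {N : L.Srt → Type u} {Γ Δ : List L.Srt}
    (σ : ∀ ⦃s : L.Srt⦄, Var Γ s → Var Δ s ⊕ D s) (d : ∀ ⦃s : L.Srt⦄, D s → N s)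
    (v : Tuple N Δ) : Tuple N Γ :=
  fun _ x => (σ x).elim (fun y => v y) fun a => d a

theorem Tuple.pull_liftSubst {N : L.Srt → Type u} {Γ Δ : List L.Srt} {s : L.Srt}
    (σ : ∀ ⦃s : L.Srt⦄, Var Γ s → Var Δ s ⊕ D s)
    (d : ∀ ⦃s : L.Srt⦄, D s → N s) (v : Tuple N Δ) (a : N s) :
    Tuple.pull (liftSubst s σ) d (Tuple.cons a v) = Tuple.cons a (Tuple.pull σ d v) := by
  funext t x
  cases x with
  | head => rfl
  | tail y =>
    simp only [Tuple.pull, liftSubst, Tuple.cons]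
    cases σ y <;> rfl

theorem Term.eval_subst (M : L.Struct) {Γ Δ : List L.Srt}
    (σ : ∀ ⦃s : L.Srt⦄, Var Γ s → Var Δ s ⊕ D s) (c : ∀ ⦃s : L.Srt⦄, C s → D s)
    (d : ∀ ⦃s : L.Srt⦄, D s → M.carrier s) (v : Tuple M.carrier Δ) {s : L.Srt}
    (t : Term L C Γ s) :
    (t.subst σ c).eval M d v = t.eval M (fun _ a => d (c a)) (Tuple.pull σ d v) := by
  induction t with
  | var x =>
    simp only [Term.subst, Term.eval, Tuple.pull]
    cases σ x <;> simp only [Sum.elim_inl, Sum.elim_inr, Term.eval]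
  | const a => simp only [Term.subst, Term.eval]
  | app f ts ih =>
    simp only [Term.subst, Term.eval]
    congr 1
    funext s x
    exact ih x

theorem Formula.realize_subst (M : L.Struct) (c : ∀ ⦃s : L.Srt⦄, C s → D s)
    (d : ∀ ⦃s : L.Srt⦄, D s → M.carrier s) : ∀ {Γ Δ : List L.Srt} (φ : Formula L C Γ)
    (σ : ∀ ⦃s : L.Srt⦄, Var Γ s → Var Δ s ⊕ D s) (v : Tuple M.carrier Δ),
    (φ.subst c σ).Realize M d v ↔ φ.Realize M (fun _ a => d (c a)) (Tuple.pull σ d v)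
  | _, _, .falsum, _, _ => Iff.rfl
  | _, _, .equal t₁ t₂, σ, v => by
    simp only [Formula.subst, Formula.Realize, Term.eval_subst]
  | _, _, .rel R ts, σ, v => by
    simp only [Formula.subst, Formula.Realize, Term.eval_subst]
  | _, _, .imp φ ψ, σ, v => by
    simp only [Formula.subst, Formula.Realize, Formula.realize_subst M c d φ,
      Formula.realize_subst M c d ψ]
  | _, _, .all s φ, σ, v => by
    simp only [Formula.subst, Formula.Realize, Formula.realize_subst M c d φ,
      Tuple.pull_liftSubst]

/-- The conjunction of a list of formulas. -/
def Formula.conj {Γ : List L.Srt} : List (Formula L C Γ) → Formula L C Γ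
  | [] => .imp .falsum .falsum
  | φ :: l => .imp (.imp φ (.imp (conj l) .falsum)) .falsum

theorem Formula.realize_conj (M : L.Struct) (c : ∀ ⦃s : L.Srt⦄, C s → M.carrier s)
    {Γ : List L.Srt} (v : Tuple M.carrier Γ) : ∀ l : List (Formula L C Γ),
    (conj l).Realize M c v ↔ ∀ φ ∈ l, φ.Realize M c v
  | [] => by simp [conj, Formula.Realize]
  | φ :: l => by simp [conj, Formula.Realize, Formula.realize_conj M c v l]

instance (Γ : List L.Srt) : Infinite (Formula L C Γ) := by
  let f : ℕ → Formula L C Γ := fun n => n.rec .falsum fun _ φ => .imp .falsum φ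
  refine Infinite.of_injective f fun m => ?_
  induction m with
  | zero => intro n h; cases n with
    | zero => rfl
    | succ n => cases h
  | succ m ih => intro n h; cases n with
    | zero => cases h
    | succ n => exact congrArg _ (ih (Formula.imp.inj h).2)

/-- Even without symbols, iterated implications from `falsum` give infinitely many formulas. Hence
`κ` is uncountable, which lets it absorb countable factors in the smallness estimates. -/
theorem aleph0_le_card (L : ManySortedLanguage.{u}) : ℵ₀ ≤ L.card :=
  have : Infinite (Σ Γ : List L.Srt, Formula L (fun _ => PEmpty.{u + 1}) Γ) :=
    Infinite.of_injective (fun φ : Formula L _ [] => ⟨[], φ⟩) sigma_mk_injective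
  Cardinal.aleph0_le_mk _

namespace Struct

variable {M : L.Struct}

/-! ### Small sets of parameters -/

theorem IsAmbient.aleph0_lt {κ : Cardinal.{u}} (hM : M.IsAmbient κ) : ℵ₀ < κ :=
  L.aleph0_le_card.trans_lt hM.card_lt

theorem Params.Small.sup {κ : Cardinal.{u}} (hκ : ℵ₀ ≤ κ) {A B : M.Params} (hA : A.Small κ)
    (hB : B.Small κ) : (A ⊔ B).Small κ := by
  refine lt_of_le_of_lt ?_ (Cardinal.add_lt_of_lt hκ hA hB)
  rw [Cardinal.add_def]
  refine Cardinal.mk_le_of_surjective (f := Sum.elim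
    (fun x => ⟨x.1, x.2.1, Or.inl x.2.2⟩) (fun x => ⟨x.1, x.2.1, Or.inr x.2.2⟩)) ?_
  rintro ⟨s, a, ha | ha⟩
  · exact ⟨.inl ⟨s, a, ha⟩, rfl⟩
  · exact ⟨.inr ⟨s, a, ha⟩, rfl⟩

/-- The set of elements of a family of tuples. -/
def entries {ι : Type u} {Γ : ι → List L.Srt} (v : ∀ i, Tuple M.carrier (Γ i)) : M.Params :=
  fun s => {m | ∃ i, ∃ x : Var (Γ i) s, v i x = m}

theorem small_entries {κ : Cardinal.{u}} (hκ : ℵ₀ < κ) {ι : Type u} (hι : #ι < κ)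
    {Γ : ι → List L.Srt} (v : ∀ i, Tuple M.carrier (Γ i)) : (entries v).Small κ := by
  have h : #(Σ i, Σ s, Var (Γ i) s) < κ := by
    rw [Cardinal.mk_sigma]
    refine lt_of_le_of_lt (Cardinal.sum_le_sum _ (fun _ => ℵ₀) fun i => Cardinal.mk_le_aleph0) ?_
    rw [Cardinal.sum_const']
    exact Cardinal.mul_lt_of_lt hκ.le hι hκ
  refine lt_of_le_of_lt (Cardinal.mk_le_of_surjective (f := fun x : Σ i, Σ s, Var (Γ i) s =>
    (⟨x.2.1, v x.1 x.2.2, x.1, x.2.2, rfl⟩ : Σ s, entries v s)) ?_) h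
  rintro ⟨s, _, i, x, rfl⟩
  exact ⟨⟨i, s, x⟩, rfl⟩

/-! ### Closure properties of `⋀`-definable sets -/

theorem InfDef.mono {A B : M.Params} (h : A ≤ B) {Γ : List L.Srt} {X : Set (Tuple M.carrier Γ)}
    (hX : InfDef A X) : InfDef B X := by
  obtain ⟨p, rfl⟩ := hX
  refine ⟨(fun φ => φ.subst (fun s a => ⟨a.1, h s a.2⟩) fun _ x => .inl x) '' p, ?_⟩
  ext v
  simp only [mem_ofPred_eq, forall_mem_image, FormulaOver.Holds, Formula.realize_subst]
  rfl

theorem InfDef.inter {A : M.Params} {Γ : List L.Srt} {X Y : Set (Tuple M.carrier Γ)}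
    (hX : InfDef A X) (hY : InfDef A Y) : InfDef A (X ∩ Y) := by
  rw [Set.inter_eq_iInter]
  exact InfDef.iInter fun b => by cases b <;> assumption

theorem InfDef.preimage {A : M.Params} {Γ Δ : List L.Srt} {X : Set (Tuple M.carrier Γ)}
    (hX : InfDef A X) (ρ : ∀ ⦃s : L.Srt⦄, Var Γ s → Var Δ s) :
    InfDef A {v : Tuple M.carrier Δ | (fun _ x => v (ρ x) : Tuple M.carrier Γ) ∈ X} := by
  obtain ⟨p, rfl⟩ := hX
  refine ⟨(fun φ => φ.subst (fun _ a => a) fun _ x => .inl (ρ x)) '' p, ?_⟩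
  ext v
  simp only [mem_ofPred_eq, forall_mem_image, FormulaOver.Holds, Formula.realize_subst]
  rfl

theorem InfDef.singleton {A : M.Params} {Γ : List L.Srt} (v : Tuple M.carrier Γ)
    (hv : ∀ ⦃s⦄ (x : Var Γ s), v x ∈ A s) : InfDef A {v} := by
  refine ⟨Set.range fun x : Σ s, Var Γ s => .equal (.var x.2) (.const ⟨v x.2, hv x.2⟩), ?_⟩
  ext w
  simp only [mem_singleton_iff, forall_mem_range, mem_ofPred_eq, FormulaOver.Holds,
    Formula.Realize, Term.eval]
  exact ⟨fun h x => by rw [h], fun h => by funext s x; exact h ⟨s, x⟩⟩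

/-- Projections of `⋀`-definable sets are `⋀`-definable, by saturation. -/
theorem InfDef.exists_cons {κ : Cardinal.{u}} (hM : M.IsAmbient κ) {A : M.Params}
    (hA : A.Small κ) {Γ : List L.Srt} {s : L.Srt} {X : Set (Tuple M.carrier (s :: Γ))}
    (hX : InfDef A X) : InfDef A {v | ∃ a, Tuple.cons a v ∈ X} := by
  obtain ⟨p, rfl⟩ := hX
  -- The projection is axiomatised by the formulas `∃ a, ⋀ l` for finite lists `l` from `p`, with
  -- `∃` spelled as `¬∀¬`.
  refine ⟨(fun l => .imp (.all s (.imp (Formula.conj l) .falsum)) .falsum) ''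
    {l | ∀ φ ∈ l, φ ∈ p}, ?_⟩
  ext v
  simp only [mem_ofPred_eq, forall_mem_image, FormulaOver.Holds, Formula.Realize,
    Formula.realize_conj]
  constructor
  · rintro ⟨a, ha⟩ l hl h
    exact h a fun φ hφ => ha φ (hl φ hφ)
  intro h
  -- Naming the entries of `v` turns `p` into a type in the single head variable over a set that is
  -- still small.
  let B : M.Params := A ⊔ entries fun _ : PUnit => v
  have hB : B.Small κ := hA.sup hM.aleph0_lt.le (small_entries hM.aleph0_lt
    (by simpa using Cardinal.one_lt_aleph0.trans hM.aleph0_lt) _)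
  let σ : ∀ ⦃t : L.Srt⦄, Var (s :: Γ) t → Var [s] t ⊕ B t := fun t x =>
    match t, x with
    | _, .head => .inl .head
    | _, .tail x => .inr ⟨v x, Or.inr ⟨⟨⟩, x, rfl⟩⟩
  let c : ∀ ⦃t : L.Srt⦄, A t → B t := fun t a => ⟨a.1, Or.inl a.2⟩
  have key : ∀ (φ : M.FormulaOver A (s :: Γ)) (w : Tuple M.carrier [s]),
      FormulaOver.Holds (Formula.subst c σ φ) w ↔ φ.Holds (Tuple.cons (w .head) v) := by
    intro φ w
    rw [FormulaOver.Holds, Formula.realize_subst, FormulaOver.Holds]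
    refine iff_of_eq (congrArg _ ?_)
    funext t x
    cases x <;> rfl
  obtain ⟨w, hw⟩ := hM.saturated B hB [s] (Formula.subst c σ '' p) (by
    intro q hq hqf
    obtain ⟨r, hr, rfl⟩ := Set.subset_image_iff.1 hq
    have : ∀ ψ ∈ Formula.subst c σ '' r, ∃ φ ∈ r, Formula.subst c σ φ = ψ := fun _ h => h
    choose! f hf using this
    have hl : ∀ φ, φ ∈ (hqf.image f).toFinset.toList ↔ ∃ ψ ∈ Formula.subst c σ '' r, f ψ = φ := by
      intro φ
      rw [Finset.mem_toList, Set.Finite.mem_toFinset, Set.mem_image]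
    -- A finite subset of the new type comes from a finite list in `p`, whose existential formula
    -- holds at `v` by `h`.
    by_contra! hc
    refine @h (hqf.image f).toFinset.toList (fun φ hφ => ?_) fun a ha => ?_
    · obtain ⟨ψ, hψ, rfl⟩ := (hl φ).1 hφ
      exact hr (hf ψ hψ).1
    · obtain ⟨ψ, hψ, hn⟩ := hc (Tuple.cons a fun _ x => nomatch x)
      refine hn ?_
      rw [← (hf ψ hψ).2]
      exact (key _ _).2 (ha _ ((hl _).2 ⟨ψ, hψ, rfl⟩)))
  exact ⟨w .head, fun φ hφ => (key φ w).1 (hw _ ⟨φ, hφ, rfl⟩)⟩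

theorem InfDef.exists_append {κ : Cardinal.{u}} (hM : M.IsAmbient κ) {A : M.Params}
    (hA : A.Small κ) {Δ : List L.Srt} : ∀ {Γ : List L.Srt} {X : Set (Tuple M.carrier (Γ ++ Δ))},
    InfDef A X → InfDef A {w | ∃ v : Tuple M.carrier Γ, v.append w ∈ X}
  | [], X, hX => by
    have h : {w : Tuple M.carrier Δ | ∃ v : Tuple M.carrier [], v.append w ∈ X} = X :=
      Set.ext fun w => ⟨fun ⟨_, h⟩ => h, fun h => ⟨fun _ x => (nomatch x), h⟩⟩
    rw [h]
    exact hX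
  | s :: Γ, X, hX => by
    convert InfDef.exists_append hM hA (Γ := Γ) (InfDef.exists_cons hM hA hX) using 1
    ext w
    constructor
    · rintro ⟨v, hv⟩
      exact ⟨v.rest, v .head, hv⟩
    · rintro ⟨v, a, hv⟩
      exact ⟨Tuple.cons a v, hv⟩

/-- The image of an `⋀`-definable set under an `⋀`-definable relation is `⋀`-definable. -/
theorem InfDef.exists_mem_append {κ : Cardinal.{u}} (hM : M.IsAmbient κ) {A : M.Params}
    (hA : A.Small κ) {Γ Δ : List L.Srt} {X : Set (Tuple M.carrier Γ)} (hX : InfDef A X)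
    {R : Set (Tuple M.carrier (Γ ++ Δ))} (hR : InfDef A R) :
    InfDef A {w | ∃ v ∈ X, v.append w ∈ R} := by
  convert InfDef.exists_append hM hA
    ((hX.preimage (Δ := Γ ++ Δ) fun _ x => x.inl).inter hR) using 1
  ext w
  simp only [mem_ofPred_eq, mem_inter_iff, Tuple.append_inl]
  rfl

/-- Compactness: small families of `⋀`-definable sets with the finite intersection property have
non-empty intersection. -/
theorem InfDef.nonempty_iInter {κ : Cardinal.{u}} (hM : M.IsAmbient κ) {A : M.Params}
    (hA : A.Small κ) {Γ : List L.Srt} {ι : Type*} {X : ι → Set (Tuple M.carrier Γ)}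
    (hX : ∀ i, InfDef A (X i)) (h : ∀ u : Finset ι, (⋂ i ∈ u, X i).Nonempty) :
    (⋂ i, X i).Nonempty := by
  classical
  choose p hp using hX
  obtain ⟨v, hv⟩ := hM.saturated A hA Γ (⋃ i, p i) (by
    intro q hq hqf
    have : ∀ φ : q, ∃ i, φ.1 ∈ p i := fun φ => mem_iUnion.1 (hq φ.2)
    choose f hf using this
    have := hqf.to_subtype
    have := Fintype.ofFinite q
    obtain ⟨v, hv⟩ := h (Finset.univ.image f)
    refine ⟨v, fun φ hφ => ?_⟩
    have hm := mem_iInter₂.1 hv (f ⟨φ, hφ⟩) (by simp)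
    rw [hp] at hm
    exact hm φ (hf ⟨φ, hφ⟩))
  refine ⟨v, mem_iInter.2 fun i => ?_⟩
  rw [hp]
  exact fun φ hφ => hv φ (mem_iUnion.2 ⟨i, hφ⟩)

end Struct

end ManySortedLanguage

/-! ### A topological criterion -/

/-- In a group with a topology that is coherent with a directed family of closed pieces (no
continuity of the group operations is assumed), if every piece is covered by finitely many closed
translates of a bounded set `V`, then `S * (V⁻¹ * V)` is a neighbourhood of `S`. -/
theorem mul_inv_mul_mem_nhdsSet {X I : Type*} [Group X] [TopologicalSpace X] [Preorder I]
    [IsDirectedOrder I] {P : I → Set X} (hmono : Monotone P) (hclosed : ∀ i, IsClosed (P i))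
    (hcover : ∀ x, ∃ i, x ∈ P i) (hcoh : ∀ C, (∀ i, IsClosed (C ∩ P i)) → IsClosed C) {V : Set X}
    (hbdd : ∀ i, ∃ j, P i * (V⁻¹ * V) ⊆ P j)
    (hV : ∀ i, ∃ Δ : Set X, Δ.Finite ∧ P i ⊆ Δ * V ∧ ∀ g ∈ Δ, IsClosed (g • V)) (S : Set X) :
    S * (V⁻¹ * V) ∈ 𝓝ˢ S := by
  -- `E` is the union of the translates in the finite cover of `P i` that miss `T`. If `g * w ∈ T`
  -- with `w ∈ V`, then `g * v = (g * w) * (w⁻¹ * v)` lies in `T * (V⁻¹ * V)`.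
  have hsep : ∀ (T : Set X) i, ∃ E, IsClosed E ∧ Disjoint E T ∧ P i \ (T * (V⁻¹ * V)) ⊆ E := by
    intro T i
    obtain ⟨Δ, hΔ, hP, hc⟩ := hV i
    refine ⟨⋃ g ∈ {g ∈ Δ | Disjoint (g • V) T}, g • V,
      (hΔ.sep _).isClosed_biUnion fun g hg => hc g hg.1, ?_, ?_⟩
    · simp only [disjoint_iUnion_left]
      exact fun g hg => hg.2
    · rintro x ⟨hx, hxT⟩
      obtain ⟨g, hg, v, hv, rfl⟩ := hP hx
      refine mem_biUnion (x := g) ⟨hg, ?_⟩ ⟨v, hv, rfl⟩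
      rw [Set.disjoint_left]
      rintro _ ⟨w, hw, rfl⟩ ht
      exact hxT ⟨g * w, ht, w⁻¹ * v, ⟨w⁻¹, inv_mem_inv.2 hw, v, hv, rfl⟩, by simp [mul_assoc]⟩
  let F : I → Set X := fun i => closure (P i \ (S * (V⁻¹ * V)))
  have hF : Monotone F := fun i j h => closure_mono (sdiff_subset_sdiff_left (hmono h))
  have hD : IsClosed (⋃ i, F i) := by
    refine hcoh _ fun j => ?_
    obtain ⟨k, hk⟩ := hbdd j
    suffices h : (⋃ i, F i) ∩ P j = F k ∩ P j from h ▸ isClosed_closure.inter (hclosed j)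
    refine subset_antisymm ?_ (inter_subset_inter_left _ (subset_iUnion F k))
    rintro x ⟨hx, hxj⟩
    obtain ⟨i, hi⟩ := mem_iUnion.1 hx
    obtain ⟨m, him, hkm⟩ := exists_ge_ge i k
    refine ⟨?_, hxj⟩
    -- Separation is applied to `P j`, not to `S`: points outside `P k` are outside `P j * (V⁻¹ *
    -- V)`, so they lie in a closed set missing `P j` and contribute nothing to the closure there.
    obtain ⟨E, hE, hEd, hPE⟩ := hsep (P j) m
    have hsub : P m \ (S * (V⁻¹ * V)) ⊆ P k \ (S * (V⁻¹ * V)) ∪ E := by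
      rintro y ⟨hy, hyS⟩
      by_cases hyk : y ∈ P k
      · exact Or.inl ⟨hyk, hyS⟩
      · exact Or.inr (hPE ⟨hy, fun h => hyk (hk h)⟩)
    have := closure_mono hsub (hF him hi)
    rw [closure_union, hE.closure_eq] at this
    exact this.resolve_right fun h => Set.disjoint_left.1 hEd h hxj
  rw [mem_nhdsSet_iff_exists]
  refine ⟨(⋃ i, F i)ᶜ, hD.isOpen_compl, ?_, ?_⟩
  · intro x hx hxF
    obtain ⟨i, hi⟩ := mem_iUnion.1 hxF
    obtain ⟨E, hE, hEd, hPE⟩ := hsep S i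
    exact Set.disjoint_left.1 hEd (closure_minimal hPE hE hi) hx
  · intro x hx
    by_contra hxS
    obtain ⟨i, hi⟩ := hcover x
    exact hx (mem_iUnion.2 ⟨i, subset_closure ⟨hi, hxS⟩⟩)

/-! ### Splitting concatenated tuples and enlarging parameter sets -/

/-- Recovers the individual representatives from a concatenated tuple in the preimage of a relation.
-/
theorem ManySortedLanguage.Tuple.append_inj {S : Type u} {M : S → Type u} {Δ : List S} :
    ∀ {Γ : List S} {v v' : Tuple M Γ} {w w' : Tuple M Δ},
      v.append w = v'.append w' → v = v' ∧ w = w'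
  | [], _, _, _, _, h => ⟨funext fun _ => funext fun x => (nomatch x), h⟩
  | t :: Γ, v, v', w, w', h => by
    have h1 := Tuple.append_inj (congrArg (Tuple.rest (Γ := Γ ++ Δ)) h :
      v.rest.append w = v'.rest.append w')
    have h2 : v .head = v' .head :=
      congrArg (fun u : Tuple M (t :: (Γ ++ Δ)) => u .head) h
    refine ⟨?_, h1.2⟩
    rw [← v.cons_head_rest, ← v'.cons_head_rest, h1.1, h2]

variable {L : ManySortedLanguage.{u}} {M : L.Struct}

theorem HyperSet.IsOver.mono {A B : M.Params} (h : A ≤ B) {P : HyperSet M} (hP : P.IsOver A) :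
    P.IsOver B :=
  ⟨hP.carrier.mono h, hP.equiv.mono h⟩

namespace PiecewiseHyperSet

/-! ### Pieces -/

theorem IsOver.mono {A B : M.Params} (h : A ≤ B) {P : PiecewiseHyperSet M} (hP : P.IsOver A) :
    P.IsOver B :=
  ⟨fun i => (hP.part i).mono h, fun i j hij => (hP.map i j hij).mono h⟩

theorem incl_map (P : PiecewiseHyperSet M) {i j : P.I} (h : i ≤ j) (x : (P.part i).Elt) :
    P.incl j (P.map i j h x) = P.incl i x :=
  Quotient.sound ⟨j, le_rfl, h, DirectedSystem.map_self' P.map _⟩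

theorem piece_mono (P : PiecewiseHyperSet M) : Monotone P.piece := by
  rintro i j h _ ⟨x, rfl⟩
  exact ⟨_, P.incl_map h x⟩

theorem exists_incl_proj_eq (P : PiecewiseHyperSet M) (g : P.Elt) :
    ∃ (i : P.I) (x : (P.part i).X), P.incl i ((P.part i).proj x) = g := by
  obtain ⟨⟨i, x⟩, rfl⟩ := Quotient.exists_rep g
  obtain ⟨x, rfl⟩ := Quotient.exists_rep x
  exact ⟨i, x, rfl⟩

theorem exists_mem_piece (P : PiecewiseHyperSet M) (g : P.Elt) : ∃ i, g ∈ P.piece i := by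
  obtain ⟨i, x, rfl⟩ := P.exists_incl_proj_eq g
  exact ⟨i, _, rfl⟩

/-- The index of a part containing a chosen representative of `g`. -/
noncomputable def repIndex (P : PiecewiseHyperSet M) (g : P.Elt) : P.I :=
  (P.exists_incl_proj_eq g).choose

/-- A chosen representative of `g`. -/
noncomputable def rep (P : PiecewiseHyperSet M) (g : P.Elt) : (P.part (P.repIndex g)).X :=
  (P.exists_incl_proj_eq g).choose_spec.choose

theorem incl_rep (P : PiecewiseHyperSet M) (g : P.Elt) :
    P.incl (P.repIndex g) ((P.part (P.repIndex g)).proj (P.rep g)) = g :=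
  (P.exists_incl_proj_eq g).choose_spec.choose_spec

/-- The parameters occurring in the chosen representatives of the elements of `Δ`. -/
noncomputable def repParams (P : PiecewiseHyperSet M) (Δ : Set P.Elt) : M.Params :=
  Struct.entries fun g : Δ => (P.rep g.1).1

theorem PiecewiseInfDef.mono {A B : M.Params} (h : A ≤ B) {P : PiecewiseHyperSet M}
    {V : Set P.Elt} (hV : P.PiecewiseInfDef A V) : P.PiecewiseInfDef B V :=
  fun i => Struct.InfDef.mono h (hV i)

theorem isClosed_logicTopology_iff {A : M.Params} {P : PiecewiseHyperSet M} (hP : P.IsOver A)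
    {C : Set P.Elt} : @IsClosed _ (P.logicTopology A hP) C ↔ P.PiecewiseInfDef A C := by
  rw [← @isOpen_compl_iff _ _ (P.logicTopology A hP)]
  change P.PiecewiseInfDef A Cᶜᶜ ↔ _
  rw [compl_compl]

/-- Used both to make the logic topology coherent with the pieces and to truncate a closed set to
one piece. -/
theorem incl_preimage_inter_piece (P : PiecewiseHyperSet M) (C : Set P.Elt) (i : P.I) :
    P.incl i ⁻¹' (C ∩ P.piece i) = P.incl i ⁻¹' C := by
  ext x
  simp [piece]

theorem small_repParams {κ : Cardinal.{u}} (hM : M.IsAmbient κ) {P : PiecewiseHyperSet M}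
    {Δ : Set P.Elt} (hΔ : #Δ < κ) : (P.repParams Δ).Small κ :=
  Struct.small_entries hM.aleph0_lt hΔ _

/-! ### Translates -/

variable {G : PiecewiseHyperSet M} [Group G.Elt] {κ : Cardinal.{u}} {A : M.Params}

theorem IsGroupOver.mono {B : M.Params} (h : A ≤ B) (hG : G.IsGroupOver A) : G.IsGroupOver B :=
  ⟨hG.isOver.mono h, hG.mul_bounded, hG.inv_bounded, fun i j k => (hG.mul_infDef i j k).mono h,
    fun i j => (hG.inv_infDef i j).mono h⟩

/-- The representative of `g` is a definable point over `A`. Fixing it as first coordinate of the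
graph of multiplication and projecting along the preimage of `V` gives `g • V`; boundedness of `V`
allows a single part `i` for the second coordinate. -/
theorem IsGroupOver.smul_of_subset_piece (hM : M.IsAmbient κ) (hA : A.Small κ)
    (hG : G.IsGroupOver A) {Δ : Set G.Elt} (hΔ : G.repParams Δ ≤ A) {g : G.Elt} (hg : g ∈ Δ)
    {V : Set G.Elt} {i : G.I} (hVi : V ⊆ G.piece i) (hV : (G.part i).InfDef A (G.incl i ⁻¹' V)) :
    G.PiecewiseInfDef A (g • V) := by
  intro k
  have h := Struct.InfDef.exists_mem_append hM hA hV (Struct.InfDef.exists_mem_append hM hA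
    (Struct.InfDef.singleton (G.rep g).1 fun s x => hΔ s ⟨⟨g, hg⟩, x, rfl⟩)
    (hG.mul_infDef (G.repIndex g) i k))
  unfold HyperSet.InfDef
  convert h using 1
  ext z
  constructor
  · rintro ⟨z, rfl, v, hv, hvz⟩
    obtain ⟨y, rfl⟩ := hVi hv
    obtain ⟨y, rfl⟩ := Quotient.exists_rep y
    refine ⟨y.1, ⟨y, rfl, hv⟩, _, rfl, G.rep g, y, z, rfl, ?_⟩
    beta_reduce
    rw [incl_rep]
    exact hvz
  · rintro ⟨_, ⟨y, rfl, hy⟩, _, rfl, x', y', z', h, hmul⟩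
    obtain ⟨h1, h2⟩ := Tuple.append_inj h
    obtain ⟨h3, rfl⟩ := Tuple.append_inj h2
    obtain rfl := Subtype.ext h1
    obtain rfl := Subtype.ext h3
    rw [incl_rep] at hmul
    exact ⟨z', rfl, _, hy, hmul⟩

theorem IsGroupOver.smul_subset_piece (hG : G.IsGroupOver A) (g : G.Elt) (i : G.I) :
    ∃ j, g • G.piece i ⊆ G.piece j := by
  obtain ⟨l, hl⟩ := G.exists_mem_piece g
  obtain ⟨j, hj⟩ := hG.mul_bounded l i
  exact ⟨j, (smul_set_subset_mul hl).trans hj⟩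

/-- Reduces to the bounded case: inside piece `k` only the part of `C` in `g⁻¹ • G.piece k` matters,
and that set lies in a single piece. -/
theorem IsGroupOver.piecewiseInfDef_smul (hM : M.IsAmbient κ) (hA : A.Small κ)
    (hG : G.IsGroupOver A) {Δ : Set G.Elt} (hΔ : G.repParams Δ ≤ A) {g : G.Elt} (hg : g ∈ Δ)
    {C : Set G.Elt} (hC : G.PiecewiseInfDef A C) : G.PiecewiseInfDef A (g • C) := by
  intro k
  obtain ⟨i, hi⟩ := hG.smul_subset_piece g⁻¹ k
  have h := hG.smul_of_subset_piece hM hA hΔ hg (V := C ∩ G.piece i) inter_subset_right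
    (by rw [incl_preimage_inter_piece]; exact hC i) k
  convert h using 1
  ext x
  simp only [mem_preimage, mem_smul_set_iff_inv_smul_mem, mem_inter_iff, iff_self_and]
  exact fun _ => hi (smul_mem_smul_set ⟨x, rfl⟩)

/-- A piece is its own translate by `1`, so the result on translates applies once a representative
of `1` is among the parameters. -/
theorem IsGroupOver.infDef_piece (hM : M.IsAmbient κ) (hA : A.Small κ) (hG : G.IsGroupOver A)
    {Δ : Set G.Elt} (hΔ : G.repParams Δ ≤ A) (h1 : 1 ∈ Δ) (i : G.I) : G.InfDef A (G.piece i) := by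
  refine ⟨?_, i, subset_rfl⟩
  rw [← one_smul G.Elt (G.piece i)]
  refine hG.smul_of_subset_piece hM hA hΔ h1 subset_rfl ?_
  have h : (G.part i).preimage (G.incl i ⁻¹' G.piece i) = (G.part i).X := by
    ext v
    constructor
    · rintro ⟨x, rfl, -⟩
      exact x.2
    · exact fun hv => ⟨⟨v, hv⟩, rfl, _, rfl⟩
  rw [HyperSet.InfDef, h]
  exact (hG.isOver.part i).carrier

/-! ### The Generic Set Lemma -/

/-- One small `A` must make all the pieces, and enough translates of `V` to cover each of them
finitely, closed at the same time. -/
theorem IsGeneric.exists_params (hM : M.IsAmbient κ) (hG : G.IsPiecewiseHyperdefinableGroup κ)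
    {V : Set G.Elt} (hV : G.IsGeneric κ V) :
    ∃ (A : M.Params) (_ : A.Small κ) (hA : G.IsGroupOver A), (∃ i, V ⊆ G.piece i) ∧
      (∀ i, G.InfDef A (G.piece i)) ∧
      ∀ S : Set G.Elt, S * (V⁻¹ * V) ∈ @nhdsSet _ (G.logicTopology A hA.isOver) S := by
  obtain ⟨⟨A₀, hA₀, hGA₀⟩, hcof⟩ := hG
  obtain ⟨⟨A₁, hA₁, hVA₁, i₀, hi₀⟩, hgen⟩ := hV
  have hone : #({1} : Set G.Elt) < κ := by
    rw [Cardinal.mk_singleton]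
    exact Cardinal.one_lt_aleph0.trans hM.aleph0_lt
  -- A preliminary parameter set, needed because genericity yields covers of a piece only when the
  -- piece is known to be `⋀`-definable.
  have hA₂ := hA₀.sup hM.aleph0_lt.le (small_repParams hM hone)
  have hsmall_piece : ∀ i, G.SmallInfDef κ (G.piece i) := fun i =>
    ⟨_, hA₂, (hGA₀.mono le_sup_left).infDef_piece hM hA₂ le_sup_right (mem_singleton 1) i⟩
  choose Δ hΔf hΔ using fun i => hgen _ (hsmall_piece i)
  obtain ⟨T, hT, hTcard⟩ := Order.exists_cof_eq G.I
  -- Only indices in a cofinal set of minimal size are used, because `G.I` itself may have size at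
  -- least `κ`; other pieces inherit the cover of a larger one.
  let Θ : Set G.Elt := {1} ∪ ⋃ i : T, Δ i
  have hΘ : #Θ < κ := by
    refine (Cardinal.mk_union_le _ _).trans_lt (Cardinal.add_lt_of_lt hM.aleph0_lt.le hone ?_)
    refine (Cardinal.mk_iUnion_le_sum_mk).trans_lt ((Cardinal.sum_le_sum _ (fun _ => ℵ₀)
      fun i : T => (hΔf i).countable.le_aleph0).trans_lt ?_)
    rw [Cardinal.sum_const']
    exact Cardinal.mul_lt_of_lt hM.aleph0_lt.le (hTcard ▸ hcof) hM.aleph0_lt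
  let A := A₀ ⊔ A₁ ⊔ G.repParams Θ
  have hA : A.Small κ :=
    (hA₀.sup hM.aleph0_lt.le hA₁).sup hM.aleph0_lt.le (small_repParams hM hΘ)
  have hGA : G.IsGroupOver A := hGA₀.mono (le_sup_left.trans le_sup_left)
  have hpiece := hGA.infDef_piece hM hA le_sup_right (Or.inl rfl : (1 : G.Elt) ∈ Θ)
  refine ⟨A, hA, hGA, ⟨i₀, hi₀⟩, hpiece, ?_⟩
  let := G.logicTopology A hGA.isOver
  refine mul_inv_mul_mem_nhdsSet G.piece_mono
    (fun i => (isClosed_logicTopology_iff hGA.isOver).2 (hpiece i).1) G.exists_mem_piece ?_ ?_ ?_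
  · intro C hC
    refine (isClosed_logicTopology_iff hGA.isOver).2 fun i => ?_
    rw [← incl_preimage_inter_piece]
    exact (isClosed_logicTopology_iff hGA.isOver).1 (hC i) i
  · intro i
    obtain ⟨j, hj⟩ := hGA.inv_bounded i₀
    obtain ⟨k, hk⟩ := hGA.mul_bounded j i₀
    obtain ⟨l, hl⟩ := hGA.mul_bounded i k
    exact ⟨l, (mul_subset_mul_left ((mul_subset_mul ((inv_subset_inv.2 hi₀).trans hj) hi₀).trans
      hk)).trans hl⟩
  · intro i
    obtain ⟨t, ht, hit⟩ := hT i
    refine ⟨Δ t, hΔf t, (G.piece_mono hit).trans (hΔ t), fun g hg => ?_⟩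
    refine (isClosed_logicTopology_iff hGA.isOver).2 ?_
    exact hGA.piecewiseInfDef_smul hM hA le_sup_right
      (Or.inr (mem_iUnion.2 ⟨⟨t, ht⟩, hg⟩) : g ∈ Θ) (hVA₁.mono (le_sup_right.trans le_sup_left))

/-- With `x ∈ P l` and `V = P i`, the neighbourhood `P l * (V⁻¹ * V)` lies in a piece `P m`, which
is itself `⋀_A`-definable. Symmetry of `P i` plays no role. -/
theorem isLocallyHyperdefinable_of_isGeneric_piece (hM : M.IsAmbient κ)
    (hG : G.IsPiecewiseHyperdefinableGroup κ) {i : G.I} (hi : G.IsGeneric κ (G.piece i)) :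
    G.IsLocallyHyperdefinable κ := by
  obtain ⟨A, hA, hGA, -, hpiece, hnhds⟩ := hi.exists_params hM hG
  refine ⟨A, hA, hGA.isOver, fun x => ?_⟩
  obtain ⟨l, hl⟩ := G.exists_mem_piece x
  obtain ⟨j, hj⟩ := hGA.inv_bounded i
  obtain ⟨k, hk⟩ := hGA.mul_bounded j i
  obtain ⟨m, hm⟩ := hGA.mul_bounded l k
  refine ⟨G.piece m, hpiece m, ?_⟩
  let := G.logicTopology A hGA.isOver
  refine Filter.mem_of_superset (nhds_le_nhdsSet hl (hnhds (G.piece l))) ?_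
  exact (mul_subset_mul_left ((mul_subset_mul_right hj).trans hk)).trans hm

/-- The piece containing a neighbourhood of `1` is generic: otherwise, by compactness, some point of
a piece would avoid every translate of the open set `U`, including the one by itself. -/
theorem IsLocallyHyperdefinable.exists_isGeneric_piece (hM : M.IsAmbient κ)
    (hG : G.IsPiecewiseHyperdefinableGroup κ) (hcard : #G.Elt < κ)
    (hloc : G.IsLocallyHyperdefinable κ) : ∃ i, G.IsGeneric κ (G.piece i) := by
  obtain ⟨A₀, hA₀, hGA₀⟩ := hG.exists_isGroupOver
  obtain ⟨A₁, hA₁, hover, hnhds⟩ := hloc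
  obtain ⟨N, ⟨-, i, hNi⟩, hN⟩ := hnhds 1
  let := G.logicTopology A₁ hover
  obtain ⟨U, hUN, hU, h1U⟩ := mem_nhds_iff.1 hN
  -- By construction of the logic topology, openness unfolds to definability of the complement.
  have hU : G.PiecewiseInfDef A₁ Uᶜ := hU
  let A := A₀ ⊔ A₁ ⊔ G.repParams univ
  have hA : A.Small κ := (hA₀.sup hM.aleph0_lt.le hA₁).sup hM.aleph0_lt.le
    (small_repParams hM (by rwa [Cardinal.mk_univ]))
  have hGA : G.IsGroupOver A := hGA₀.mono (le_sup_left.trans le_sup_left)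
  have hUA : G.PiecewiseInfDef A Uᶜ := hU.mono (le_sup_right.trans le_sup_left)
  refine ⟨i, ⟨A, hA, hGA.infDef_piece hM hA le_sup_right (mem_univ 1) i⟩, ?_⟩
  rintro W ⟨-, -, -, j, hWj⟩
  by_contra! hW
  obtain ⟨v, hv⟩ := Struct.InfDef.nonempty_iInter hM hA
    (fun g : G.Elt => hGA.piecewiseInfDef_smul hM hA le_sup_right (mem_univ g) hUA j) (by
      intro u
      obtain ⟨y, hy, hyu⟩ := not_subset.1 (hW u u.finite_toSet)
      obtain ⟨x, rfl⟩ := hWj hy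
      obtain ⟨x, rfl⟩ := Quotient.exists_rep x
      -- A point of `W` outside the finitely many translates of piece `i` is outside those of `U`,
      -- since `U ⊆ G.piece i`.
      refine ⟨x.1, mem_iInter₂.2 fun g hg => ⟨x, rfl, ?_⟩⟩
      refine mem_smul_set_iff_inv_smul_mem.2 fun h => hyu ?_
      exact ⟨g, hg, _, hNi (hUN h), mul_inv_cancel_left _ _⟩)
  rw [mem_iInter] at hv
  -- Any group element would do here: the only information taken is that `v` represents a point of
  -- piece `j`.
  obtain ⟨x, rfl, -⟩ := hv 1
  -- Translating by the point itself gives `1 ∈ Uᶜ`, a contradiction.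
  obtain ⟨x', hx', h⟩ := hv (G.incl j ((G.part j).proj x))
  obtain rfl := Subtype.ext hx'
  refine mem_smul_set_iff_inv_smul_mem.1 h ?_
  rw [smul_eq_mul, inv_mul_cancel]
  exact h1U

end PiecewiseHyperSet

theorem theoremt {L : ManySortedLanguage.{u}} (M : L.Struct) (κ : Cardinal.{u})
    (hM : M.IsAmbient κ) (G : PiecewiseHyperSet M) [Group G.Elt]
    (hG : G.IsPiecewiseHyperdefinableGroup κ) :
    (∀ V : Set G.Elt, 1 ∈ V → V⁻¹ = V → G.IsGeneric κ V →
      ∃ (A : M.Params) (_ : A.Small κ) (hA : G.IsOver A),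
        ∀ n : ℕ, V ^ (n + 2) ∈ @nhdsSet _ (G.logicTopology A hA) (V ^ n)) ∧
    ((∃ i, G.IsGeneric κ (G.piece i)) → G.IsLocallyHyperdefinable κ) ∧
    (#G.Elt < κ → (G.IsLocallyHyperdefinable κ ↔ ∃ i, G.IsGeneric κ (G.piece i))) := by
  have hloc : (∃ i, G.IsGeneric κ (G.piece i)) → G.IsLocallyHyperdefinable κ :=
    fun ⟨_, hi⟩ => PiecewiseHyperSet.isLocallyHyperdefinable_of_isGeneric_piece hM hG hi
  refine ⟨fun V _ hinv hV => ?_, hloc, fun hcard =>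
    ⟨fun h => h.exists_isGeneric_piece hM hG hcard, hloc⟩⟩
  obtain ⟨A, hA, hGA, -, -, hnhds⟩ := hV.exists_params hM hG
  refine ⟨A, hA, hGA.isOver, fun n => ?_⟩
  have h := hnhds (V ^ n)
  -- Symmetry turns `V⁻¹ * V` into `V ^ 2`, the source of the shift by two.
  rwa [hinv, ← pow_two, ← pow_add] at h
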